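/- Let $G$ be a locally compact (Hausdorff) group, $N$ a closed normal subgroup of $G$, and $\xi:N\to\mathbb{T}$ a continuous character which is $G$-invariant, i.e. $\xi(x^{-1}sx)=\xi(s)$ for all $x\in G$, $s\in N$. Fix a left Haar measure $\lambda_{G/N}$ on $G/N$. Let $\mathcal{C}_\xi(G,N)$ be the space of continuous functions $\psi:G\to\mathbb{C}$ such that $\psi(xk)=\xi(k)\psi(x)$ for all $x\in G$, $k\in N$ and the image of $\operatorname{supp}\psi$ in $G/N$ is compact. For $\psi,\phi\in\mathcal{C}_\xi(G,N)$ the covariant convolution is \[ (\psi\natural\phi)(x)=\int_{G/N}\psi(y)\phi(y^{-1}x)\,\mathrm{d}\lambda_{G/N}(yN)\qquad(x\in G), \] which is again an element of $\mathcal{C}_\xi(G,N)$. For $1\le p<\infty$ let $L^p_\xi(G,N)$ be the Banach completion of $\mathcal{C}_\xi(G,N)$ with respect to the norm $\|\psi\|_{(p)}=\left(\int_{G/N}|\psi(y)|^p\,\mathrm{d}\lambda_{G/N}(yN)\right)^{1/p}$. Then: 1. The covariant convolution on $\mathcal{C}_\xi(G,N)$ has a unique (jointly) continuous extension $\natural:L^1_\xi(G,N)\times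 L^1_\xi(G,N)\to L^1_\xi(G,N)$, and $L^1_\xi(G,N)$ with this product is a (not necessarily unital) Banach algebra: the product is bilinear and associative, and $\|\psi\natural\phi\|_{(1)}\le\|\psi\|_{(1)}\|\phi\|_{(1)}$. 2. For every $1<p<\infty$, the covariant convolution on $\mathcal{C}_\xi(G,N)$ has a unique (jointly) continuous extension $\natural:L^1_\xi(G,N)\times L^p_\xi(G,N)\to L^p_\xi(G,N)$, and $L^p_\xi(G,N)$ with this action is a Banach left $L^1_\xi(G,N)$-module: the action is bilinear, $(\psi\natural\phi)\natural\chi=\psi\natural(\phi\natural\chi)$ for $\psi,\phi\in L^1_\xi(G,N)$ and $\chi\in L^p_\xi(G,N)$, and $\|\psi\natural\chi\|_{(p)}\le\|\psi\|_{(1)}\|\chi\|_{(p)}$. -/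

import Mathlib

open MeasureTheory Topology

set_option linter.unusedSectionVars false

namespace CovariantConv

section Basic

variable {G : Type*} [Group G] [TopologicalSpace G]

/-- The set `Γ(G, N)` of continuous characters `ξ : N → 𝕋` with `ξ (x⁻¹ s x) = ξ s` for all
`x ∈ G`, `s ∈ N`. -/
def InvariantCharacters (N : Subgroup G) [N.Normal] : Set (N →ₜ* Circle) :=
  {ξ | ∀ (x : G) (s : N), ξ (MulAut.conjNormal x⁻¹ s) = ξ s}

/-- The covariance property `ψ (x k) = ξ (k) ψ (x)`. -/
def IsCovariant {N : Subgroup G} (ξ : N →ₜ* Circle) (ψ : G → ℂ) : Prop :=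
  ∀ (x : G) (k : N), ψ (x * k) = (ξ k : ℂ) * ψ x

/-- `ψ` has compact support modulo `N`: the image of `supp ψ` in `G ⧸ N` is compact. -/
def HasCompactSupportMod (N : Subgroup G) (ψ : G → ℂ) : Prop :=
  IsCompact ((QuotientGroup.mk : G → G ⧸ N) '' tsupport ψ)

theorem IsCovariant.norm_eq {N : Subgroup G} {ξ : N →ₜ* Circle} {ψ : G → ℂ}
    (h : IsCovariant ξ ψ) (x : G) (k : N) : ‖ψ (x * k)‖ = ‖ψ x‖ := by
  rw [h x k, norm_mul, Circle.norm_coe, one_mul]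

/-- The well-defined function `xN ↦ |ψ (x)|` on `G ⧸ N`, for a covariant function `ψ`. -/
noncomputable def absQ {N : Subgroup G} {ξ : N →ₜ* Circle} {ψ : G → ℂ} (h : IsCovariant ξ ψ) : G ⧸ N → ℝ :=
  Quotient.lift (fun x => ‖ψ x‖) (by
    intro a b hab
    have h1 : a⁻¹ * b ∈ N := QuotientGroup.leftRel_apply.mp hab
    have h2 := h.norm_eq a ⟨a⁻¹ * b, h1⟩
    simp only [mul_inv_cancel_left] at h2
    exact h2.symm)

@[simp]
theorem absQ_mk {N : Subgroup G} {ξ : N →ₜ* Circle} {ψ : G → ℂ} (h : IsCovariant ξ ψ) (x : G) :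
    absQ h (x : G ⧸ N) = ‖ψ x‖ := rfl

theorem absQ_nonneg {N : Subgroup G} {ξ : N →ₜ* Circle} {ψ : G → ℂ} (h : IsCovariant ξ ψ)
    (q : G ⧸ N) : 0 ≤ absQ h q := by
  induction q using QuotientGroup.induction_on with
  | H x => simp

theorem continuous_absQ {N : Subgroup G} {ξ : N →ₜ* Circle} {ψ : G → ℂ} (h : IsCovariant ξ ψ)
    (hc : Continuous ψ) : Continuous (absQ h) :=
  Continuous.quotient_lift hc.norm _

variable [IsTopologicalGroup G]

theorem image_tsupport {N : Subgroup G} {ξ : N →ₜ* Circle} {ψ : G → ℂ} (h : IsCovariant ξ ψ) :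
    (QuotientGroup.mk : G → G ⧸ N) '' tsupport ψ = tsupport (absQ h) := by
  have h1 : Function.support ψ = (QuotientGroup.mk : G → G ⧸ N) ⁻¹' Function.support (absQ h) := by
    ext x
    simp
  rw [tsupport, h1, ← QuotientGroup.isOpenMap_coe.preimage_closure_eq_closure_preimage
    QuotientGroup.continuous_mk, Set.image_preimage_eq _ QuotientGroup.mk_surjective]
  rfl

theorem hasCompactSupportMod_iff {N : Subgroup G} {ξ : N →ₜ* Circle} {ψ : G → ℂ}
    (h : IsCovariant ξ ψ) : HasCompactSupportMod N ψ ↔ HasCompactSupport (absQ h) := by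
  rw [HasCompactSupportMod, image_tsupport h]
  rfl

/-- The space `C_ξ(G, N)` of continuous covariant functions of `ξ` whose support has compact image
in `G ⧸ N`. -/
def CovariantFunctions {N : Subgroup G} (ξ : N →ₜ* Circle) : Submodule ℂ C(G, ℂ) where
  carrier := {ψ | HasCompactSupportMod N ψ ∧ IsCovariant ξ ψ}
  zero_mem' := by
    refine ⟨?_, fun x k => by simp⟩
    have : tsupport (⇑(0 : C(G, ℂ))) = ∅ := by
      rw [tsupport_eq_empty_iff]; rfl
    rw [HasCompactSupportMod, this, Set.image_empty]
    exact isCompact_empty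
  add_mem' := by
    rintro ψ φ ⟨hψ, cψ⟩ ⟨hφ, cφ⟩
    have cs : IsCovariant ξ ⇑(ψ + φ) := fun x k => by
      simp only [ContinuousMap.add_apply]
      rw [cψ x k, cφ x k, mul_add]
    refine ⟨?_, cs⟩
    rw [HasCompactSupportMod, image_tsupport cs]
    refine IsCompact.of_isClosed_subset (hψ.union hφ) (isClosed_tsupport _) ?_
    rw [← image_tsupport cs, ← Set.image_union]
    exact Set.image_mono (tsupport_add _ _)
  smul_mem' := by
    rintro c ψ ⟨hψ, cψ⟩
    have cs : IsCovariant ξ ⇑(c • ψ) := fun x k => by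
      simp only [ContinuousMap.smul_apply, smul_eq_mul]
      rw [cψ x k, mul_left_comm]
    refine ⟨?_, cs⟩
    rw [HasCompactSupportMod, image_tsupport cs]
    refine IsCompact.of_isClosed_subset hψ (isClosed_tsupport _) ?_
    rw [← image_tsupport cs]
    exact Set.image_mono (closure_mono fun x hx => by
      contrapose! hx
      simp only [Function.mem_support, not_not] at hx
      simp [hx])

end Basic

section Norm

variable {G : Type*} [Group G] [TopologicalSpace G] [IsTopologicalGroup G]
  {N : Subgroup G} [N.Normal] [MeasurableSpace (G ⧸ N)]

/-- `‖ψ‖₍ₚ₎ = (∫_{G ⧸ N} |ψ (y)| ^ p dμ(yN)) ^ (1 / p)`. -/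
noncomputable def covNorm (μ : Measure (G ⧸ N)) {ξ : N →ₜ* Circle} (p : ℝ)
    (ψ : CovariantFunctions ξ) : ℝ :=
  (∫ q, absQ ψ.2.2 q ^ p ∂μ) ^ (1 / p)

/-- The vector space `C_ξ(G, N)`, to be given the norm `‖·‖₍ₚ₎`. -/
def NormedCovariantFunctions (_μ : Measure (G ⧸ N)) (ξ : N →ₜ* Circle) (_p : ℝ) : Type _ :=
  CovariantFunctions ξ

variable (μ : Measure (G ⧸ N)) (ξ : N →ₜ* Circle) (p : ℝ)

noncomputable instance : AddCommGroup (NormedCovariantFunctions μ ξ p) :=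
  inferInstanceAs (AddCommGroup (CovariantFunctions ξ))

noncomputable instance : Module ℂ (NormedCovariantFunctions μ ξ p) :=
  inferInstanceAs (Module ℂ (CovariantFunctions ξ))

noncomputable instance : Norm (NormedCovariantFunctions μ ξ p) :=
  ⟨fun ψ => covNorm μ p (ξ := ξ) ψ⟩

instance : Fact ((1 : ℝ) ≤ 1) := ⟨le_rfl⟩

variable {ξ}

theorem hasCompactSupport_absQ (ψ : CovariantFunctions ξ) : HasCompactSupport (absQ ψ.2.2) :=
  (hasCompactSupportMod_iff ψ.2.2).mp ψ.2.1

variable [BorelSpace (G ⧸ N)] [μ.IsHaarMeasure]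

theorem memLp_absQ (ψ : CovariantFunctions ξ) (r : ENNReal) : MemLp (absQ ψ.2.2) r μ :=
  (continuous_absQ ψ.2.2 ψ.1.continuous).memLp_of_hasCompactSupport (hasCompactSupport_absQ ψ)

theorem covNorm_eq (hp : 1 ≤ p) (ψ : CovariantFunctions ξ) :
    covNorm μ p ψ = (eLpNorm (absQ ψ.2.2) (ENNReal.ofReal p) μ).toReal := by
  have hp0 : 0 < p := by linarith
  rw [(memLp_absQ μ ψ _).eLpNorm_eq_integral_rpow_norm (by simpa using hp0) (by simp),
    ENNReal.toReal_ofReal hp0.le, ENNReal.toReal_ofReal (by positivity), covNorm, one_div]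
  simp only [Real.norm_of_nonneg (absQ_nonneg _ _)]

theorem covNorm_nonneg (hp : 1 ≤ p) (ψ : CovariantFunctions ξ) : 0 ≤ covNorm μ p ψ := by
  rw [covNorm_eq μ p hp]
  exact ENNReal.toReal_nonneg

theorem covNorm_add_le (hp : 1 ≤ p) (ψ φ : CovariantFunctions ξ) :
    covNorm μ p (ψ + φ) ≤ covNorm μ p ψ + covNorm μ p φ := by
  rw [covNorm_eq μ p hp, covNorm_eq μ p hp, covNorm_eq μ p hp,
    ← ENNReal.toReal_add (memLp_absQ μ ψ _).eLpNorm_ne_top (memLp_absQ μ φ _).eLpNorm_ne_top]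
  refine ENNReal.toReal_mono (ENNReal.add_ne_top.mpr
    ⟨(memLp_absQ μ ψ _).eLpNorm_ne_top, (memLp_absQ μ φ _).eLpNorm_ne_top⟩) ?_
  refine le_trans (eLpNorm_mono_real (g := absQ ψ.2.2 + absQ φ.2.2) ?_)
    (eLpNorm_add_le (memLp_absQ μ ψ 1).1 (memLp_absQ μ φ 1).1 (by simpa using hp))
  intro q
  induction q using QuotientGroup.induction_on with
  | H x => simpa using norm_add_le (ψ.1 x) (φ.1 x)

theorem covNorm_smul (hp : 1 ≤ p) (c : ℂ) (ψ : CovariantFunctions ξ) :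
    covNorm μ p (c • ψ) = ‖c‖ * covNorm μ p ψ := by
  have h : absQ (c • ψ).2.2 = ‖c‖ • absQ ψ.2.2 := by
    ext q
    induction q using QuotientGroup.induction_on with
    | H x => simp
  rw [covNorm_eq μ p hp, covNorm_eq μ p hp, h, eLpNorm_const_smul, ENNReal.toReal_mul]
  simp

theorem covNorm_eq_zero_iff (hp : 1 ≤ p) (ψ : CovariantFunctions ξ) :
    covNorm μ p ψ = 0 ↔ ψ = 0 := by
  rw [covNorm_eq μ p hp, ENNReal.toReal_eq_zero_iff,
    or_iff_left (memLp_absQ μ ψ _).eLpNorm_ne_top,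
    eLpNorm_eq_zero_iff (memLp_absQ μ ψ 1).1 (by simpa using by linarith),
    (continuous_absQ ψ.2.2 ψ.1.continuous).ae_eq_iff_eq μ continuous_zero]
  constructor
  · intro h
    ext x
    simpa using congrFun h (x : G ⧸ N)
  · rintro rfl
    ext q
    induction q using QuotientGroup.induction_on with
    | H x => simp

variable (ξ)

theorem normCore [hp : Fact (1 ≤ p)] : NormedSpace.Core ℂ (NormedCovariantFunctions μ ξ p) where
  norm_nonneg ψ := covNorm_nonneg μ p hp.out (ξ := ξ) ψ
  norm_smul c ψ := covNorm_smul μ p hp.out c ψ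
  norm_triangle ψ φ := covNorm_add_le μ p hp.out ψ φ
  norm_eq_zero_iff ψ := covNorm_eq_zero_iff μ p hp.out ψ

noncomputable instance [Fact (1 ≤ p)] : NormedAddCommGroup (NormedCovariantFunctions μ ξ p) :=
  NormedAddCommGroup.ofCore (normCore μ ξ p)

noncomputable instance [Fact (1 ≤ p)] : NormedSpace ℂ (NormedCovariantFunctions μ ξ p) :=
  NormedSpace.ofCore (normCore μ ξ p)

/-- The Banach space `L^p_ξ(G, N)`: the completion of `C_ξ(G, N)` with respect to `‖·‖₍ₚ₎`. -/
abbrev CovariantLp [Fact (1 ≤ p)] : Type _ :=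
  UniformSpace.Completion (NormedCovariantFunctions μ ξ p)

/-- The canonical embedding `C_ξ(G, N) → L^p_ξ(G, N)`. -/
noncomputable def toCovariantLp [Fact (1 ≤ p)] : CovariantFunctions ξ →ₗ[ℂ] CovariantLp μ ξ p :=
  (UniformSpace.Completion.toComplₗᵢ
    (𝕜 := ℂ) (E := NormedCovariantFunctions μ ξ p)).toLinearMap

end Norm

section Conv

variable {G : Type*} [Group G] [TopologicalSpace G] [IsTopologicalGroup G]
  {N : Subgroup G} [N.Normal]

/-- The function `yN ↦ ψ (y) φ (y⁻¹ x)` on `G ⧸ N`. -/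
noncomputable def convIntegrand (ξ : InvariantCharacters N) (ψ φ : CovariantFunctions ξ.1) (x : G) :
    G ⧸ N → ℂ :=
  Quotient.lift (fun y => ψ.1 y * φ.1 (y⁻¹ * x)) (by
    intro a b hab
    obtain ⟨s, rfl⟩ : ∃ s : N, b = a * s :=
      ⟨⟨a⁻¹ * b, QuotientGroup.leftRel_apply.mp hab⟩, by simp⟩
    have e : (a * (s : G))⁻¹ * x
        = (a⁻¹ * x) * (MulAut.conjNormal (a⁻¹ * x)⁻¹ s⁻¹ : N) := by
      rw [MulAut.conjNormal_apply]
      push_cast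
      group
    have h1 : (ξ.1 s : ℂ) * (ξ.1 s⁻¹ : ℂ) = 1 := by
      rw [← Circle.coe_mul, ← map_mul, mul_inv_cancel, map_one, Circle.coe_one]
    have h2 := ψ.2.2 a s
    have h3 := φ.2.2 (a⁻¹ * x) (MulAut.conjNormal (a⁻¹ * x)⁻¹ s⁻¹)
    rw [ξ.2 (a⁻¹ * x) s⁻¹] at h3
    simp only [e]
    rw [h2, h3]
    linear_combination (-(ψ.1 a * φ.1 (a⁻¹ * x))) * h1)

@[simp]
theorem convIntegrand_mk (ξ : InvariantCharacters N) (ψ φ : CovariantFunctions ξ.1) (x y : G) :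
    convIntegrand ξ ψ φ x (y : G ⧸ N) = ψ.1 y * φ.1 (y⁻¹ * x) := rfl

theorem continuous_convIntegrand (ξ : InvariantCharacters N) (ψ φ : CovariantFunctions ξ.1) :
    Continuous (fun z : G × (G ⧸ N) => convIntegrand ξ ψ φ z.1 z.2) := by
  have hq : IsQuotientMap (Prod.map (id : G → G) (QuotientGroup.mk : G → G ⧸ N)) :=
    (IsOpenQuotientMap.id.prodMap QuotientGroup.isOpenQuotientMap_mk).isQuotientMap
  rw [hq.continuous_iff]
  change Continuous (fun z : G × G => ψ.1 z.2 * φ.1 (z.2⁻¹ * z.1))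
  fun_prop

theorem convIntegrand_eq_zero (ξ : InvariantCharacters N) (ψ φ : CovariantFunctions ξ.1) (x : G)
    (q : G ⧸ N) (hq : q ∉ (QuotientGroup.mk : G → G ⧸ N) '' tsupport ψ.1) :
    convIntegrand ξ ψ φ x q = 0 := by
  induction q using QuotientGroup.induction_on with
  | H y =>
    have : ψ.1 y = 0 := by
      by_contra h
      exact hq ⟨y, subset_tsupport _ h, rfl⟩
    simp [this]

variable [MeasurableSpace (G ⧸ N)] [BorelSpace (G ⧸ N)]
  (μ : Measure (G ⧸ N)) [μ.IsHaarMeasure]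

theorem continuous_conv (ξ : InvariantCharacters N) (ψ φ : CovariantFunctions ξ.1) :
    Continuous (fun x => ∫ q, convIntegrand ξ ψ φ x q ∂μ) := by
  rw [← continuousOn_univ]
  exact continuousOn_integral_of_compact_support ψ.2.1
    (continuous_convIntegrand ξ ψ φ).continuousOn
    (fun x q _ hq => convIntegrand_eq_zero ξ ψ φ x q hq)

theorem isCovariant_conv (ξ : InvariantCharacters N) (ψ φ : CovariantFunctions ξ.1) :
    IsCovariant ξ.1 (fun x => ∫ q, convIntegrand ξ ψ φ x q ∂μ) := by
  intro x k
  simp only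
  rw [← integral_const_mul]
  congr 1
  ext q
  induction q using QuotientGroup.induction_on with
  | H y =>
    have h := φ.2.2 (y⁻¹ * x) k
    rw [mul_assoc] at h
    simp only [convIntegrand_mk]
    rw [h]
    ring

theorem hasCompactSupportMod_conv (ξ : InvariantCharacters N) (ψ φ : CovariantFunctions ξ.1) :
    HasCompactSupportMod N (fun x => ∫ q, convIntegrand ξ ψ φ x q ∂μ) := by
  rw [hasCompactSupportMod_iff (isCovariant_conv μ ξ ψ φ)]
  refine HasCompactSupport.intro' (ψ.2.1.mul φ.2.1) ?_ ?_
  · rw [image_tsupport φ.2.2]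
    exact (isClosed_tsupport _).mul_left_of_isCompact ψ.2.1
  · intro q hq
    induction q using QuotientGroup.induction_on with
    | H x =>
      rw [absQ_mk, norm_eq_zero]
      refine integral_eq_zero_of_ae (Filter.Eventually.of_forall fun r => ?_)
      induction r using QuotientGroup.induction_on with
      | H y =>
        by_contra h
        simp only [convIntegrand_mk, Pi.zero_apply, mul_eq_zero, not_or] at h
        refine hq ⟨_, ⟨y, subset_tsupport _ h.1, rfl⟩, _,
          ⟨y⁻¹ * x, subset_tsupport _ h.2, rfl⟩, ?_⟩
        simp [← QuotientGroup.mk_mul]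

/-- The covariant convolution `(ψ ♮ φ) (x) = ∫_{G ⧸ N} ψ (y) φ (y⁻¹ x) dμ(yN)` on `C_ξ(G, N)`. -/
noncomputable def covConv (ξ : InvariantCharacters N) (ψ φ : CovariantFunctions ξ.1) :
    CovariantFunctions ξ.1 :=
  ⟨⟨fun x => ∫ q, convIntegrand ξ ψ φ x q ∂μ, continuous_conv μ ξ ψ φ⟩,
    hasCompactSupportMod_conv μ ξ ψ φ, isCovariant_conv μ ξ ψ φ⟩

end Conv

section Banach

/-- The complex normed space `A` with the product `mul` is a Banach algebra
(not necessarily unital). -/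
structure IsBanachAlgebra {A : Type*} [NormedAddCommGroup A] [NormedSpace ℂ A]
    (mul : A → A → A) : Prop where
  complete : CompleteSpace A
  add_mul : ∀ a b c, mul (a + b) c = mul a c + mul b c
  mul_add : ∀ a b c, mul a (b + c) = mul a b + mul a c
  smul_mul : ∀ (z : ℂ) (a b), mul (z • a) b = z • mul a b
  mul_smul : ∀ (z : ℂ) (a b), mul a (z • b) = z • mul a b
  mul_assoc : ∀ a b c, mul (mul a b) c = mul a (mul b c)
  norm_mul_le : ∀ a b, ‖mul a b‖ ≤ ‖a‖ * ‖b‖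

/-- The complex normed space `E` with the action `act` is a Banach left module over the Banach
algebra `A` with the product `mul`. -/
structure IsBanachLeftModule {A E : Type*} [NormedAddCommGroup A] [NormedSpace ℂ A]
    [NormedAddCommGroup E] [NormedSpace ℂ E] (mul : A → A → A) (act : A → E → E) : Prop where
  algebra : IsBanachAlgebra mul
  complete : CompleteSpace E
  add_act : ∀ a b v, act (a + b) v = act a v + act b v
  act_add : ∀ a v w, act a (v + w) = act a v + act a w
  smul_act : ∀ (z : ℂ) (a v), act (z • a) v = z • act a v
  act_smul : ∀ (z : ℂ) (a v), act a (z • v) = z • act a v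
  mul_act : ∀ a b v, act (mul a b) v = act a (act b v)
  norm_act_le : ∀ a v, ‖act a v‖ ≤ ‖a‖ * ‖v‖

variable {G : Type*} [Group G] [TopologicalSpace G] [IsTopologicalGroup G]
  {N : Subgroup G} [N.Normal] [MeasurableSpace (G ⧸ N)] [BorelSpace (G ⧸ N)]

/-- The map `F : L^1_ξ(G, N) × L^p_ξ(G, N) → L^p_ξ(G, N)` is (jointly) continuous and extends the
covariant convolution of `C_ξ(G, N)`. -/
def IsContinuousExtension (μ : Measure (G ⧸ N)) [μ.IsHaarMeasure] (ξ : InvariantCharacters N)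
    (p : ℝ) [Fact (1 ≤ p)]
    (F : CovariantLp μ ξ.1 1 → CovariantLp μ ξ.1 p → CovariantLp μ ξ.1 p) : Prop :=
  Continuous (Function.uncurry F) ∧
    ∀ ψ φ : CovariantFunctions ξ.1,
      F (toCovariantLp μ ξ.1 1 ψ) (toCovariantLp μ ξ.1 p φ)
        = toCovariantLp μ ξ.1 p (covConv μ ξ ψ φ)

end Banach

end CovariantConv

open CovariantConv

/-! Everything is settled on the dense subspace `C_ξ(G, N)` and carried to the completions by
continuity.

The modulus of a covariant function descends to a continuous compactly supported function on the
group `G ⧸ N`, and `|ψ ♮ φ|` is bounded there by the ordinary convolution of `|ψ|` and `|φ|`. The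
bound `‖ψ ♮ φ‖₍ₚ₎ ≤ ‖ψ‖₍₁₎ ‖φ‖₍ₚ₎` (`covNorm_covConv_le`) is thus Young's inequality on `G ⧸ N`, a
consequence of Hölder, Fubini and left invariance. Associativity (`covConv_assoc`) is Fubini plus
left invariance for a triple integrand on `G ⧸ N × G ⧸ N`. Fubini is only applied to continuous
compactly supported functions, so no σ-finiteness of Haar measure is needed.

The bound makes `♮` a bounded bilinear map, which extends to `convLp`. Uniqueness, associativity and
the norm bound are closed conditions, so they pass from the dense subspace. The product is the case
`p = 1` of the action. -/

namespace CovariantConv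

/-! ### Young's inequality on a topological group -/

section Young

/-- Hölder applied to the splitting `f h = f ^ (1/q) · (f ^ (1/p) h)`, with `q` conjugate to `p`; an
unnormalised Jensen inequality for the measure `f dμ`. -/
theorem rpow_integral_mul_le {X : Type*} [TopologicalSpace X] [MeasurableSpace X]
    [OpensMeasurableSpace X] {μ : Measure X} [IsFiniteMeasureOnCompacts μ] {p : ℝ} (hp : 1 ≤ p)
    {f h : X → ℝ} (hf : Continuous f) (hfc : HasCompactSupport f) (hf0 : 0 ≤ f)
    (hh : Continuous h) (hh0 : 0 ≤ h) :
    (∫ y, f y * h y ∂μ) ^ p ≤ (∫ y, f y ∂μ) ^ (p - 1) * ∫ y, f y * h y ^ p ∂μ := by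
  -- For `p = 1` there is no finite conjugate exponent; the claim is an equality because `t ^ 0 =
  -- 1`, even at `t = 0`.
  rcases hp.eq_or_lt with rfl | hp1
  · simp
  have hpq := Real.HolderConjugate.conjExponent hp1
  set q := p.conjExponent with hq
  have hp0 : 0 < p := by linarith
  have hq0 : 0 < q := hpq.symm.pos
  have c1 : Continuous fun y => f y ^ (1 / q) :=
    hf.rpow_const fun _ => Or.inr (by positivity)
  have c2 : Continuous fun y => f y ^ (1 / p) * h y :=
    (hf.rpow_const fun _ => Or.inr (by positivity)).mul hh
  have s1 : HasCompactSupport fun y => f y ^ (1 / q) :=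
    hfc.comp_left (g := fun t : ℝ => t ^ (1 / q)) (Real.zero_rpow (by positivity))
  have s2 : HasCompactSupport fun y => f y ^ (1 / p) * h y :=
    (hfc.comp_left (g := fun t : ℝ => t ^ (1 / p)) (Real.zero_rpow (by positivity))).mul_right
  have hold := integral_mul_le_Lp_mul_Lq_of_nonneg (μ := μ) hpq.symm
    (f := fun y => f y ^ (1 / q)) (g := fun y => f y ^ (1 / p) * h y)
    (Filter.Eventually.of_forall fun y => Real.rpow_nonneg (hf0 y) _)
    (Filter.Eventually.of_forall fun y => mul_nonneg (Real.rpow_nonneg (hf0 y) _) (hh0 y))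
    (c1.memLp_of_hasCompactSupport s1) (c2.memLp_of_hasCompactSupport s2)
  have e1 : ∀ y, f y ^ (1 / q) * (f y ^ (1 / p) * h y) = f y * h y := fun y => by
    rw [← mul_assoc, ← Real.rpow_add_of_nonneg (hf0 y) (by positivity) (by positivity),
      one_div, one_div, add_comm, hpq.inv_add_inv_eq_one, Real.rpow_one]
  have e2 : ∀ y, (f y ^ (1 / q)) ^ q = f y := fun y => by
    rw [one_div, Real.rpow_inv_rpow (hf0 y) hq0.ne']
  have e3 : ∀ y, (f y ^ (1 / p) * h y) ^ p = f y * h y ^ p := fun y => by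
    rw [Real.mul_rpow (Real.rpow_nonneg (hf0 y) _) (hh0 y), one_div,
      Real.rpow_inv_rpow (hf0 y) hp0.ne']
  simp only [e1, e2, e3] at hold
  have i1 : 0 ≤ ∫ y, f y ∂μ := integral_nonneg hf0
  have i2 : 0 ≤ ∫ y, f y * h y ^ p ∂μ :=
    integral_nonneg fun y => mul_nonneg (hf0 y) (Real.rpow_nonneg (hh0 y) _)
  have i3 : 0 ≤ ∫ y, f y * h y ∂μ := integral_nonneg fun y => mul_nonneg (hf0 y) (hh0 y)
  refine (Real.rpow_le_rpow i3 hold hp0.le).trans_eq ?_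
  rw [Real.mul_rpow (by positivity) (by positivity), ← Real.rpow_mul i1, ← Real.rpow_mul i2,
    one_div_mul_cancel hp0.ne', Real.rpow_one]
  -- What remains is `1 / q * p = p - 1`.
  congr 2
  rw [hq, Real.conjExponent]
  have : p - 1 ≠ 0 := by linarith
  field_simp

variable {H : Type*} [Group H] [TopologicalSpace H] [IsTopologicalGroup H] {f g : H → ℝ}

/-- Since `x = y (y⁻¹ x)`, a nonzero value forces `x ∈ supp f · supp g` and `y ∈ supp f`. This
licenses Fubini. -/
theorem hasCompactSupport_mul_comp_inv_mul (hfc : HasCompactSupport f)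
    (hgc : HasCompactSupport g) :
    HasCompactSupport (Function.uncurry fun x y : H => f y * g (y⁻¹ * x)) := by
  refine HasCompactSupport.intro ((hfc.mul hgc).prod hfc) ?_
  rintro ⟨x, y⟩ hxy
  by_contra h
  simp only [Function.uncurry_apply_pair, mul_eq_zero, not_or] at h
  exact hxy ⟨⟨y, subset_tsupport _ h.1, y⁻¹ * x, subset_tsupport _ h.2, by simp⟩,
    subset_tsupport _ h.1⟩

variable [MeasurableSpace H] [BorelSpace H] (μ : Measure H) [μ.IsHaarMeasure]

theorem integrable_integral_mul_comp_inv_mul (hf : Continuous f) (hfc : HasCompactSupport f)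
    (hg : Continuous g) (hgc : HasCompactSupport g) :
    Integrable (fun x => ∫ y, f y * g (y⁻¹ * x) ∂μ) μ := by
  refine Continuous.integrable_of_hasCompactSupport ?_ ?_
  · rw [← continuousOn_univ]
    refine continuousOn_integral_of_compact_support hfc
      (Continuous.continuousOn (by simp only [Function.uncurry_def]; fun_prop)) fun x y _ hy => ?_
    rw [image_eq_zero_of_notMem_tsupport hy, zero_mul]
  · refine HasCompactSupport.intro (hfc.mul hgc) fun x hx => ?_
    refine integral_eq_zero_of_ae (Filter.Eventually.of_forall fun y => ?_)
    by_contra h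
    simp only [Pi.zero_apply, mul_eq_zero, not_or] at h
    exact hx ⟨y, subset_tsupport _ h.1, y⁻¹ * x, subset_tsupport _ h.2, by simp⟩

/-- After swapping, the inner integral over `x` is that of a left translate of `g`. -/
theorem integral_integral_mul_comp_inv_mul (hf : Continuous f) (hfc : HasCompactSupport f)
    (hg : Continuous g) (hgc : HasCompactSupport g) :
    ∫ x, ∫ y, f y * g (y⁻¹ * x) ∂μ ∂μ = (∫ y, f y ∂μ) * ∫ x, g x ∂μ := by
  rw [integral_integral_swap_of_hasCompactSupport
    (by simp only [Function.uncurry_def]; fun_prop) (hasCompactSupport_mul_comp_inv_mul hfc hgc)]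
  simp only [integral_const_mul, integral_mul_left_eq_self, integral_mul_const]

/-- Young's inequality for continuous compactly supported functions. -/
theorem integral_rpow_integral_mul_comp_inv_mul_le {p : ℝ} (hp : 1 ≤ p) (hf : Continuous f)
    (hfc : HasCompactSupport f) (hf0 : 0 ≤ f) (hg : Continuous g) (hgc : HasCompactSupport g)
    (hg0 : 0 ≤ g) {k : H → ℝ} (hk0 : 0 ≤ k) (hk : ∀ x, k x ≤ ∫ y, f y * g (y⁻¹ * x) ∂μ) :
    ∫ x, k x ^ p ∂μ ≤ (∫ y, f y ∂μ) ^ p * ∫ x, g x ^ p ∂μ := by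
  have hp0 : 0 < p := by linarith
  have hgp : Continuous fun x => g x ^ p := hg.rpow_const fun _ => Or.inr hp0.le
  have hgpc : HasCompactSupport fun x => g x ^ p :=
    hgc.comp_left (g := fun t : ℝ => t ^ p) (Real.zero_rpow hp0.ne')
  have hF : 0 ≤ ∫ y, f y ∂μ := integral_nonneg hf0
  calc ∫ x, k x ^ p ∂μ
      ≤ ∫ x, (∫ y, f y ∂μ) ^ (p - 1) * ∫ y, f y * g (y⁻¹ * x) ^ p ∂μ ∂μ := by
        -- Only the upper bound has to be integrable, so `k` needs no regularity.
        refine integral_mono_of_nonneg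
          (Filter.Eventually.of_forall fun x => Real.rpow_nonneg (hk0 x) _)
          ((integrable_integral_mul_comp_inv_mul μ hf hfc hgp hgpc).const_mul _)
          (Filter.Eventually.of_forall fun x => ?_)
        exact (Real.rpow_le_rpow (hk0 x) (hk x) hp0.le).trans
          (rpow_integral_mul_le hp hf hfc hf0 (hg.comp (by fun_prop)) fun y => hg0 (y⁻¹ * x))
    _ = (∫ y, f y ∂μ) ^ p * ∫ x, g x ^ p ∂μ := by
        rw [integral_const_mul, integral_integral_mul_comp_inv_mul μ hf hfc hgp hgpc, ← mul_assoc]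
        congr 1
        -- The bare factor `∫ f` is written as a first power so that the exponents `p - 1` and `1`
        -- add up, including when `∫ f = 0`.
        conv_lhs => rw [← Real.rpow_one (∫ y, f y ∂μ), ← Real.rpow_mul hF, one_mul]
        rw [← Real.rpow_add_of_nonneg hF (by linarith) zero_le_one, sub_add_cancel]

end Young

/-! ### Integrands on the quotient -/

section Conv

variable {G : Type*} [Group G] [TopologicalSpace G] [IsTopologicalGroup G]
  {N : Subgroup G} [N.Normal] (ξ : InvariantCharacters N)

/-- The link to Young's inequality: in modulus, the characters disappear and an ordinary convolution
integrand on `G ⧸ N` remains. -/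
theorem norm_convIntegrand (ψ φ : CovariantFunctions ξ.1) (x : G) (q : G ⧸ N) :
    ‖convIntegrand ξ ψ φ x q‖ = absQ ψ.2.2 q * absQ φ.2.2 (q⁻¹ * x) := by
  induction q using QuotientGroup.induction_on with
  | H y =>
    rw [← QuotientGroup.mk_inv, ← QuotientGroup.mk_mul, absQ_mk, absQ_mk, convIntegrand_mk,
      norm_mul]

/-- The function `(zN, yN) ↦ ψ (y) φ (y⁻¹ z) χ (z⁻¹ x)` on `G ⧸ N × G ⧸ N`. -/
noncomputable def tripleIntegrand (ψ φ χ : CovariantFunctions ξ.1) (x : G) (r q : G ⧸ N) : ℂ :=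
  convIntegrand ξ ψ φ r.out q * χ.1 (r.out⁻¹ * x)

/-- The chosen representative is immaterial: `φ (y⁻¹ z) χ (z⁻¹ x)` is the convolution integrand of
`φ`, `χ` at the point `y⁻¹ x` and the coset of `y⁻¹ z`, hence depends on `z` only through `zN`. -/
theorem tripleIntegrand_mk (ψ φ χ : CovariantFunctions ξ.1) (x z : G) (q : G ⧸ N) :
    tripleIntegrand ξ ψ φ χ x (z : G ⧸ N) q = convIntegrand ξ ψ φ z q * χ.1 (z⁻¹ * x) := by
  induction q using QuotientGroup.induction_on with
  | H y =>
    set w := Quotient.out (z : G ⧸ N) with hw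
    have hwz : (w : G ⧸ N) = z := QuotientGroup.out_eq' _
    obtain ⟨s, hs⟩ : ∃ s : N, z = w * s := ⟨⟨w⁻¹ * z, QuotientGroup.eq.mp hwz⟩, by simp⟩
    have key : convIntegrand ξ φ χ (y⁻¹ * x) (↑(y⁻¹ * w))
        = convIntegrand ξ φ χ (y⁻¹ * x) (↑(y⁻¹ * z)) := by
      rw [QuotientGroup.mk_mul, hwz, QuotientGroup.mk_mul]
    simp only [convIntegrand_mk] at key
    have e : ∀ v : G, (y⁻¹ * v)⁻¹ * (y⁻¹ * x) = v⁻¹ * x := fun v => by group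
    rw [e, e] at key
    simp only [tripleIntegrand, ← hw, convIntegrand_mk, mul_assoc, key]

/-- Exhibits the dependence on `r` as a left translate of a convolution integrand, ready for Haar
invariance. -/
theorem tripleIntegrand_eq (ψ φ χ : CovariantFunctions ξ.1) (x y : G) (r : G ⧸ N) :
    tripleIntegrand ξ ψ φ χ x r (y : G ⧸ N)
      = ψ.1 y * convIntegrand ξ φ χ (y⁻¹ * x) ((y : G ⧸ N)⁻¹ * r) := by
  induction r using QuotientGroup.induction_on with
  | H z =>
    have e : (y⁻¹ * z)⁻¹ * (y⁻¹ * x) = z⁻¹ * x := by group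
    rw [tripleIntegrand_mk, ← QuotientGroup.mk_inv, ← QuotientGroup.mk_mul, convIntegrand_mk,
      convIntegrand_mk, e, mul_assoc]

theorem continuous_tripleIntegrand (ψ φ χ : CovariantFunctions ξ.1) (x : G) :
    Continuous (Function.uncurry (tripleIntegrand ξ ψ φ χ x)) := by
  have hq : IsQuotientMap
      (Prod.map (QuotientGroup.mk : G → G ⧸ N) (QuotientGroup.mk : G → G ⧸ N)) :=
    (QuotientGroup.isOpenQuotientMap_mk.prodMap QuotientGroup.isOpenQuotientMap_mk).isQuotientMap
  rw [hq.continuous_iff]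
  have : Function.uncurry (tripleIntegrand ξ ψ φ χ x) ∘ Prod.map QuotientGroup.mk QuotientGroup.mk
      = fun z : G × G => ψ.1 z.2 * φ.1 (z.2⁻¹ * z.1) * χ.1 (z.1⁻¹ * x) := by
    ext z
    exact tripleIntegrand_mk ξ ψ φ χ x z.1 z.2
  rw [this]
  fun_prop

/-- The supports of `ψ` and `φ` alone confine both variables, through `z = y (y⁻¹ z)`. -/
theorem hasCompactSupport_tripleIntegrand (ψ φ χ : CovariantFunctions ξ.1) (x : G) :
    HasCompactSupport (Function.uncurry (tripleIntegrand ξ ψ φ χ x)) := by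
  refine HasCompactSupport.intro ((ψ.2.1.mul φ.2.1).prod ψ.2.1) ?_
  rintro ⟨r, q⟩ hrq
  induction r using QuotientGroup.induction_on with
  | H z =>
    induction q using QuotientGroup.induction_on with
    | H y =>
      by_contra h
      simp only [Function.uncurry_apply_pair, tripleIntegrand_mk, convIntegrand_mk, mul_eq_zero,
        not_or] at h
      refine hrq ⟨⟨_, ⟨y, subset_tsupport _ h.1.1, rfl⟩, _,
        ⟨y⁻¹ * z, subset_tsupport _ h.1.2, rfl⟩, ?_⟩, ⟨y, subset_tsupport _ h.1.1, rfl⟩⟩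
      simp

end Conv

/-! ### Bilinearity, norm bound and associativity on `C_ξ(G, N)` -/

section Conv

variable {G : Type*} [Group G] [TopologicalSpace G] [IsTopologicalGroup G]
  {N : Subgroup G} [N.Normal] [MeasurableSpace (G ⧸ N)] [BorelSpace (G ⧸ N)]
  (μ : Measure (G ⧸ N)) [μ.IsHaarMeasure] (ξ : InvariantCharacters N)

theorem covConv_apply (ψ φ : CovariantFunctions ξ.1) (x : G) :
    (covConv μ ξ ψ φ).1 x = ∫ q, convIntegrand ξ ψ φ x q ∂μ := rfl

theorem integrable_convIntegrand (ψ φ : CovariantFunctions ξ.1) (x : G) :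
    Integrable (convIntegrand ξ ψ φ x) μ :=
  ((continuous_convIntegrand ξ ψ φ).comp (Continuous.prodMk_right x)).integrable_of_hasCompactSupport
    (HasCompactSupport.intro ψ.2.1 fun q hq => convIntegrand_eq_zero ξ ψ φ x q hq)

theorem covConv_add_left (ψ₁ ψ₂ φ : CovariantFunctions ξ.1) :
    covConv μ ξ (ψ₁ + ψ₂) φ = covConv μ ξ ψ₁ φ + covConv μ ξ ψ₂ φ := by
  ext x
  rw [Submodule.coe_add, ContinuousMap.add_apply, covConv_apply, covConv_apply, covConv_apply]
  rw [← integral_add (integrable_convIntegrand μ ξ _ _ x) (integrable_convIntegrand μ ξ _ _ x)]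
  congr 1 with q
  induction q using QuotientGroup.induction_on with
  | H y => simp [add_mul]

theorem covConv_add_right (ψ φ₁ φ₂ : CovariantFunctions ξ.1) :
    covConv μ ξ ψ (φ₁ + φ₂) = covConv μ ξ ψ φ₁ + covConv μ ξ ψ φ₂ := by
  ext x
  rw [Submodule.coe_add, ContinuousMap.add_apply, covConv_apply, covConv_apply, covConv_apply]
  rw [← integral_add (integrable_convIntegrand μ ξ _ _ x) (integrable_convIntegrand μ ξ _ _ x)]
  congr 1 with q
  induction q using QuotientGroup.induction_on with
  | H y => simp [mul_add]

theorem covConv_smul_left (c : ℂ) (ψ φ : CovariantFunctions ξ.1) :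
    covConv μ ξ (c • ψ) φ = c • covConv μ ξ ψ φ := by
  ext x
  change ∫ q, _ ∂μ = c * ∫ q, _ ∂μ
  rw [← integral_const_mul]
  congr 1 with q
  induction q using QuotientGroup.induction_on with
  | H y => simp [mul_assoc]

theorem covConv_smul_right (c : ℂ) (ψ φ : CovariantFunctions ξ.1) :
    covConv μ ξ ψ (c • φ) = c • covConv μ ξ ψ φ := by
  ext x
  change ∫ q, _ ∂μ = c * ∫ q, _ ∂μ
  rw [← integral_const_mul]
  congr 1 with q
  induction q using QuotientGroup.induction_on with
  | H y => simp [mul_left_comm]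

theorem covNorm_covConv_le {p : ℝ} (hp : 1 ≤ p) (ψ φ : CovariantFunctions ξ.1) :
    covNorm μ p (covConv μ ξ ψ φ) ≤ covNorm μ 1 ψ * covNorm μ p φ := by
  have hp0 : 0 < p := by linarith
  have hψ : 0 ≤ ∫ q, absQ ψ.2.2 q ∂μ := integral_nonneg (absQ_nonneg _)
  have hφ : 0 ≤ ∫ q, absQ φ.2.2 q ^ p ∂μ :=
    integral_nonneg fun q => Real.rpow_nonneg (absQ_nonneg _ q) _
  have key := integral_rpow_integral_mul_comp_inv_mul_le μ hp
    (continuous_absQ ψ.2.2 ψ.1.continuous) (hasCompactSupport_absQ ψ) (absQ_nonneg _)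
    (continuous_absQ φ.2.2 φ.1.continuous) (hasCompactSupport_absQ φ) (absQ_nonneg _)
    (k := absQ (covConv μ ξ ψ φ).2.2) (absQ_nonneg _) fun q => by
      induction q using QuotientGroup.induction_on with
      | H x =>
        rw [absQ_mk, covConv_apply]
        refine (norm_integral_le_integral_norm _).trans_eq ?_
        simp only [norm_convIntegrand]
  have h0 : 0 ≤ ∫ q, absQ (covConv μ ξ ψ φ).2.2 q ^ p ∂μ :=
    integral_nonneg fun q => Real.rpow_nonneg (absQ_nonneg _ q) _
  refine (Real.rpow_le_rpow h0 key (by positivity)).trans_eq ?_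
  rw [Real.mul_rpow (by positivity) hφ, ← Real.rpow_mul hψ, mul_one_div_cancel hp0.ne']
  simp [covNorm]

theorem covConv_assoc (ψ φ χ : CovariantFunctions ξ.1) :
    covConv μ ξ (covConv μ ξ ψ φ) χ = covConv μ ξ ψ (covConv μ ξ φ χ) := by
  ext x
  have h1 : ∀ r, convIntegrand ξ (covConv μ ξ ψ φ) χ x r
      = ∫ q, tripleIntegrand ξ ψ φ χ x r q ∂μ := fun r => by
    induction r using QuotientGroup.induction_on with
    | H z => simp only [tripleIntegrand_mk, integral_mul_const, convIntegrand_mk, covConv_apply]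
  have h2 : ∀ q, convIntegrand ξ ψ (covConv μ ξ φ χ) x q
      = ∫ r, tripleIntegrand ξ ψ φ χ x r q ∂μ := fun q => by
    induction q using QuotientGroup.induction_on with
    | H y =>
      simp only [tripleIntegrand_eq, integral_const_mul, convIntegrand_mk, covConv_apply]
      -- Left invariance removes the translation by `yN` in the variable `r`.
      rw [integral_mul_left_eq_self (convIntegrand ξ φ χ (y⁻¹ * x))]
  change ∫ r, _ ∂μ = ∫ q, _ ∂μ
  simp only [h1, h2]
  exact integral_integral_swap_of_hasCompactSupport (continuous_tripleIntegrand ξ ψ φ χ x)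
    (hasCompactSupport_tripleIntegrand ξ ψ φ χ x)

end Conv

/-! ### Extension to the completions -/

section Extension

variable {G : Type*} [Group G] [TopologicalSpace G] [IsTopologicalGroup G]
  {N : Subgroup G} [N.Normal] [MeasurableSpace (G ⧸ N)] [BorelSpace (G ⧸ N)]
  (μ : Measure (G ⧸ N)) [μ.IsHaarMeasure] (ξ : InvariantCharacters N) (p : ℝ) [hp : Fact (1 ≤ p)]

theorem norm_toCovariantLp (ψ : CovariantFunctions ξ.1) :
    ‖toCovariantLp μ ξ.1 p ψ‖ = covNorm μ p ψ :=
  UniformSpace.Completion.norm_coe (E := NormedCovariantFunctions μ ξ.1 p) ψ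

theorem denseRange_toCovariantLp : DenseRange (toCovariantLp μ ξ.1 p) :=
  UniformSpace.Completion.denseRange_coe (α := NormedCovariantFunctions μ ξ.1 p)

/-- The covariant convolution as a continuous bilinear map from `C_ξ(G, N) × C_ξ(G, N)`
to `L^p_ξ(G, N)`. -/
noncomputable def covConvL : NormedCovariantFunctions μ ξ.1 1 →L[ℂ]
    NormedCovariantFunctions μ ξ.1 p →L[ℂ] CovariantLp μ ξ.1 p :=
  LinearMap.mkContinuous₂
    (LinearMap.mk₂ ℂ (M := NormedCovariantFunctions μ ξ.1 1)
      (Nₗ := NormedCovariantFunctions μ ξ.1 p)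
      (fun ψ φ => toCovariantLp μ ξ.1 p (covConv μ ξ ψ φ))
      (fun ψ₁ ψ₂ φ => (congrArg _ (covConv_add_left μ ξ ψ₁ ψ₂ φ)).trans (map_add _ _ _))
      (fun c ψ φ => (congrArg _ (covConv_smul_left μ ξ c ψ φ)).trans (map_smul _ _ _))
      (fun ψ φ₁ φ₂ => (congrArg _ (covConv_add_right μ ξ ψ φ₁ φ₂)).trans (map_add _ _ _))
      (fun c ψ φ => (congrArg _ (covConv_smul_right μ ξ c ψ φ)).trans (map_smul _ _ _)))
    1 fun ψ φ => by
      rw [one_mul]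
      exact (norm_toCovariantLp μ ξ p _).trans_le (covNorm_covConv_le μ ξ hp.out ψ φ)

/-- The continuous bilinear extension of the covariant convolution to
`L^1_ξ(G, N) × L^p_ξ(G, N)`. -/
noncomputable def convLp : CovariantLp μ ξ.1 1 →L[ℂ] CovariantLp μ ξ.1 p →L[ℂ] CovariantLp μ ξ.1 p :=
  -- One variable is extended at a time: first the `L^1` variable, then, after a flip, the `L^p`
  -- variable.
  ((((covConvL μ ξ p).extend UniformSpace.Completion.toComplL).flip).extend
    UniformSpace.Completion.toComplL).flip

theorem convLp_toCovariantLp (ψ φ : CovariantFunctions ξ.1) :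
    convLp μ ξ p (toCovariantLp μ ξ.1 1 ψ) (toCovariantLp μ ξ.1 p φ)
      = toCovariantLp μ ξ.1 p (covConv μ ξ ψ φ) := by
  have h1 := ContinuousLinearMap.extend_eq (covConvL μ ξ p)
    (e := UniformSpace.Completion.toComplL) UniformSpace.Completion.denseRange_coe
    (UniformSpace.Completion.isUniformInducing_coe _) ψ
  have h2 := ContinuousLinearMap.extend_eq
    (((covConvL μ ξ p).extend UniformSpace.Completion.toComplL).flip)
    (e := UniformSpace.Completion.toComplL) UniformSpace.Completion.denseRange_coe
    (UniformSpace.Completion.isUniformInducing_coe _) φ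
  refine (congrArg (fun T => T (toCovariantLp μ ξ.1 1 ψ)) h2).trans ?_
  exact congrArg (fun T => T φ) h1

theorem continuous_convLp :
    Continuous fun z : CovariantLp μ ξ.1 1 × CovariantLp μ ξ.1 p => convLp μ ξ p z.1 z.2 :=
  (convLp μ ξ p).continuous₂

theorem isContinuousExtension_convLp :
    IsContinuousExtension μ ξ p fun a v => convLp μ ξ p a v :=
  ⟨continuous_convLp μ ξ p, convLp_toCovariantLp μ ξ p⟩

/-- Two continuous maps into a Hausdorff space that agree on the dense image of `C_ξ(G, N) × C_ξ(G,
N)` are equal. -/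
theorem IsContinuousExtension.eq_convLp
    {F : CovariantLp μ ξ.1 1 → CovariantLp μ ξ.1 p → CovariantLp μ ξ.1 p}
    (hF : IsContinuousExtension μ ξ p F) : F = fun a v => convLp μ ξ p a v := by
  have h := ((denseRange_toCovariantLp μ ξ 1).prodMap (denseRange_toCovariantLp μ ξ p)).equalizer
    hF.1 (continuous_convLp μ ξ p) (funext fun z => by
      exact (hF.2 z.1 z.2).trans (convLp_toCovariantLp μ ξ p z.1 z.2).symm)
  funext a v
  exact congrFun h (a, v)

theorem norm_convLp_le (a : CovariantLp μ ξ.1 1) (v : CovariantLp μ ξ.1 p) :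
    ‖convLp μ ξ p a v‖ ≤ ‖a‖ * ‖v‖ := by
  have dense : ∀ ψ φ : CovariantFunctions ξ.1,
      ‖convLp μ ξ p (toCovariantLp μ ξ.1 1 ψ) (toCovariantLp μ ξ.1 p φ)‖
        ≤ ‖toCovariantLp μ ξ.1 1 ψ‖ * ‖toCovariantLp μ ξ.1 p φ‖ := fun ψ φ => by
    rw [convLp_toCovariantLp, norm_toCovariantLp, norm_toCovariantLp, norm_toCovariantLp]
    exact covNorm_covConv_le μ ξ hp.out ψ φ
  induction a, v using UniformSpace.Completion.induction_on₂ with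
  | hp =>
    exact isClosed_le (continuous_convLp μ ξ p).norm
      (continuous_fst.norm.mul continuous_snd.norm)
  | ih ψ φ => exact dense ψ φ

/-- Both sides are jointly continuous, so `covConv_assoc` on the dense subspace suffices. Gives the
algebra law at `p = 1` and the module law in general. -/
theorem convLp_assoc (a b : CovariantLp μ ξ.1 1) (v : CovariantLp μ ξ.1 p) :
    convLp μ ξ p (convLp μ ξ 1 a b) v = convLp μ ξ p a (convLp μ ξ p b v) := by
  have dense : ∀ ψ φ χ : CovariantFunctions ξ.1,
      convLp μ ξ p (convLp μ ξ 1 (toCovariantLp μ ξ.1 1 ψ) (toCovariantLp μ ξ.1 1 φ))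
          (toCovariantLp μ ξ.1 p χ)
        = convLp μ ξ p (toCovariantLp μ ξ.1 1 ψ)
          (convLp μ ξ p (toCovariantLp μ ξ.1 1 φ) (toCovariantLp μ ξ.1 p χ)) := fun ψ φ χ => by
    simp only [convLp_toCovariantLp, covConv_assoc]
  induction a, b, v using UniformSpace.Completion.induction_on₃ with
  | hp => exact isClosed_eq (by fun_prop) (by fun_prop)
  | ih ψ φ χ => exact dense ψ φ χ

theorem isBanachAlgebra_convLp : IsBanachAlgebra fun a b => convLp μ ξ 1 a b where
  complete := inferInstance
  add_mul a b c := by simp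
  mul_add a b c := by simp
  smul_mul z a b := by simp
  mul_smul z a b := by simp
  mul_assoc := convLp_assoc μ ξ 1
  norm_mul_le := norm_convLp_le μ ξ 1

theorem isBanachLeftModule_convLp :
    IsBanachLeftModule (fun a b => convLp μ ξ 1 a b) fun a v => convLp μ ξ p a v where
  algebra := isBanachAlgebra_convLp μ ξ
  complete := inferInstance
  add_act a b c := by simp
  act_add a b c := by simp
  smul_act z a b := by simp
  act_smul z a b := by simp
  mul_act := convLp_assoc μ ξ p
  norm_act_le := norm_convLp_le μ ξ p

end Extension

end CovariantConv

theorem mainTheorem3 {G : Type*} [Group G] [TopologicalSpace G] [IsTopologicalGroup G]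
    [LocallyCompactSpace G] [T2Space G] (N : Subgroup G) [N.Normal] (hN : IsClosed (N : Set G))
    [MeasurableSpace (G ⧸ N)] [BorelSpace (G ⧸ N)] (μ : Measure (G ⧸ N)) [μ.IsHaarMeasure]
    (ξ : InvariantCharacters N) :
    ∃ conv : CovariantLp μ ξ.1 1 → CovariantLp μ ξ.1 1 → CovariantLp μ ξ.1 1,
      IsContinuousExtension μ ξ 1 conv ∧
      (∀ F, IsContinuousExtension μ ξ 1 F → F = conv) ∧
      IsBanachAlgebra conv ∧
      ∀ (p : ℝ) [Fact (1 ≤ p)], 1 < p →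
        ∃ act : CovariantLp μ ξ.1 1 → CovariantLp μ ξ.1 p → CovariantLp μ ξ.1 p,
          IsContinuousExtension μ ξ p act ∧
          (∀ F, IsContinuousExtension μ ξ p F → F = act) ∧
          IsBanachLeftModule conv act :=
  ⟨fun a b => convLp μ ξ 1 a b, isContinuousExtension_convLp μ ξ 1,
    fun _ hF => hF.eq_convLp, isBanachAlgebra_convLp μ ξ, fun p _ _ =>
    ⟨fun a v => convLp μ ξ p a v, isContinuousExtension_convLp μ ξ p,
      fun _ hF => hF.eq_convLp, isBanachLeftModule_convLp μ ξ p⟩⟩
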